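/- Let $X\neq\{0\}$ be a complex Banach space with open unit ball $\mathbb{B}$. For $z\in X\setminus\{0\}$ let $T(z)=\{\ell\in L(X,\mathbb{C}):\ \ell(z)=\|z\|,\ \|\ell\|=1\}$, and for a bounded linear operator $A\in L(X)$ let $m(A)=\inf\{\Re\,\ell(A(z)):\ \|z\|=1,\ \ell\in T(z)\}$. A Schwarz mapping is a holomorphic mapping $f:\mathbb{B}\to\mathbb{B}$ with $f(0)=0$; a mapping is univalent on $\mathbb{B}$ if it is holomorphic and injective on $\mathbb{B}$; it is biholomorphic on $\mathbb{B}$ if it is holomorphic on $\mathbb{B}$, its image is a domain, and it has an inverse that is holomorphic on the image. There exist constants $M(r)>0$ and $\tilde M(r)=\frac{1+r}{1-r}M(r)$, $r\in(0,1)$, depending only on $r$, such that the following holds for every such $X$. Let $A\in L(X)$ satisfy $m(A)>0$, and let $v(\cdot,s,t)$, $0\le s\le t<\infty$, be a family of Schwarz mappings with $Dv(0,s,t)=e^{-(t-s)A}$ for $t\ge s\ge 0$ and with the semigroup property $$v(v(z,s,t),t,u)=v(z,s,u),\qquad z\in\mathbb{B},\quad 0\le s\le t\le u<\infty.$$ Then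 $v(z,s,s)=z$ for all $z\in\mathbb{B}$ and $s\ge 0$, and for every $r\in(0,1)$: (i) $\|v(z,s,t_1)-v(z,s,t_2)\|\le M(r)\,\|A\|\,(t_2-t_1)$ for $\|z\|\le r$ and $0\le s\le t_1<t_2$; (ii) $\|v(z,s_1,t)-v(z,s_2,t)\|\le \tilde M(r)\,\|A\|\,(s_2-s_1)$ for $\|z\|\le r$ and $0\le s_1<s_2\le t$. Moreover, if $v(\cdot,s,t)$ is univalent on $\mathbb{B}$ for all $t\ge s\ge 0$, then $v(\cdot,s,t)$ is biholomorphic on $\mathbb{B}$ for all $t\ge s\ge 0$. -/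

import Mathlib

open Set Metric

/-- The set `T(z)` of norm-one continuous linear functionals `ℓ` with `ℓ z = ‖z‖`. -/
def supportFunctionals {X : Type*} [NormedAddCommGroup X] [NormedSpace ℂ X] (z : X) :
    Set (X →L[ℂ] ℂ) :=
  {l | l z = ((‖z‖ : ℝ) : ℂ) ∧ ‖l‖ = 1}

/-- `m(A) = inf {Re (ℓ (A z)) : ‖z‖ = 1, ℓ ∈ T(z)}`. -/
noncomputable def lowerNumericalBound {X : Type*} [NormedAddCommGroup X] [NormedSpace ℂ X]
    (A : X →L[ℂ] X) : ℝ :=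
  sInf {x : ℝ | ∃ z : X, ‖z‖ = 1 ∧ ∃ l ∈ supportFunctionals z, x = (l (A z)).re}

/-- A Schwarz mapping: a holomorphic self-map of the open unit ball which fixes the origin. -/
def IsSchwarzMap {X : Type*} [NormedAddCommGroup X] [NormedSpace ℂ X] (f : X → X) : Prop :=
  DifferentiableOn ℂ f (ball 0 1) ∧ MapsTo f (ball 0 1) (ball 0 1) ∧ f 0 = 0

/-- A univalent mapping: holomorphic and injective on `Ω`. -/
def IsUnivalentOn {X Y : Type*} [NormedAddCommGroup X] [NormedSpace ℂ X]
    [NormedAddCommGroup Y] [NormedSpace ℂ Y] (f : X → Y) (Ω : Set X) : Prop :=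
  DifferentiableOn ℂ f Ω ∧ InjOn f Ω

/-- A biholomorphic mapping: `f` is holomorphic on `Ω`, its image `f(Ω)` is a domain (open and
connected), and `f` has an inverse which is holomorphic on `f(Ω)`. -/
def IsBiholomorphicOn {X Y : Type*} [NormedAddCommGroup X] [NormedSpace ℂ X]
    [NormedAddCommGroup Y] [NormedSpace ℂ Y] (f : X → Y) (Ω : Set X) : Prop :=
  DifferentiableOn ℂ f Ω ∧ IsOpen (f '' Ω) ∧ IsConnected (f '' Ω) ∧
    ∃ g : Y → X, LeftInvOn g f Ω ∧ DifferentiableOn ℂ g (f '' Ω)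

/-- `v z s t` (used for `z` in the open unit ball and `0 ≤ s ≤ t` only) is a family of Schwarz
mappings with the semigroup property `v(v(z,s,t),t,u) = v(z,s,u)` and with
`Dv(0,s,t) = exp(-(t-s)A)`. -/
structure IsSchwarzSemigroupFamily {X : Type*} [NormedAddCommGroup X] [NormedSpace ℂ X]
    (A : X →L[ℂ] X) (v : X → ℝ → ℝ → X) : Prop where
  schwarz : ∀ s t : ℝ, 0 ≤ s → s ≤ t → IsSchwarzMap (fun z => v z s t)
  semigroup : ∀ s t u : ℝ, 0 ≤ s → s ≤ t → t ≤ u → ∀ z ∈ ball (0 : X) 1,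
    v (v z s t) t u = v z s u
  deriv_zero : ∀ s t : ℝ, 0 ≤ s → s ≤ t →
    HasFDerivAt (fun z => v z s t) (NormedSpace.exp (-(((t - s : ℝ) : ℂ) • A))) 0

/-! Everything rests on a quantitative Cartan uniqueness theorem, `IsSchwarzMap.norm_sub_apply_le`:
a Schwarz map with derivative `D` at `0` differs from the identity on `‖z‖ ≤ r` by at most a
multiple of `‖1 - D‖` depending only on `r`. Along a complex line, a support functional turns `h =
id - f` into a scalar function with nonnegative real part after division by `ζ`, and
Borel–Carathéodory bounds the numerical range of `h`. To pass to the norm, the vector field `h` is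
followed for complex time: the numerical range limits radial growth, so Euler polygons stay in a
ball, and Cauchy's estimate in time bounds `h z`.

For the family, `exp (-τA)` is a contraction, being the derivative at `0` of a Schwarz map, so `‖1 -
exp (-τA)‖ ≤ ‖A‖ τ`. This gives `v z s s = z` and, with the semigroup property, the bound in `t`;
the bound in `s` also uses the Lipschitz constant of the outer map. Short-time derivatives are
invertible by a Neumann series, all derivatives by the chain rule, and the inverse function theorem
upgrades univalent to biholomorphic. -/

/-! ### Cauchy estimates in normed spaces. -/

theorem norm_deriv_le_div_of_forall_mem_ball {F : Type*} [NormedAddCommGroup F] [NormedSpace ℂ F]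
    {f : ℂ → F} {c : ℂ} {R C : ℝ} (hR : 0 < R) (hd : DifferentiableOn ℂ f (ball c R))
    (hC : ∀ z ∈ ball c R, ‖f z‖ ≤ C) : ‖deriv f c‖ ≤ C / R := by
  have hlim : Filter.Tendsto (fun ρ : ℝ => C / ρ) (nhdsWithin R (Iio R)) (nhds (C / R)) :=
    (tendsto_const_nhds.div Filter.tendsto_id hR.ne').mono_left nhdsWithin_le_nhds
  refine ge_of_tendsto hlim ?_
  filter_upwards [Ioo_mem_nhdsLT hR] with ρ hρ
  have hsub : closedBall c ρ ⊆ ball c R := closedBall_subset_ball hρ.2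
  refine Complex.norm_deriv_le_of_forall_mem_sphere_norm_le hρ.1
    ((hd.mono ?_).diffContOnCl) fun z hz => hC z (hsub (sphere_subset_closedBall hz))
  exact closure_ball_subset_closedBall.trans hsub

section HolomorphicBounds

variable {E F : Type*} [NormedAddCommGroup E] [NormedSpace ℂ E]
  [NormedAddCommGroup F] [NormedSpace ℂ F] {f : E → F} {c : E} {R C : ℝ}

/-- Cauchy's estimate for the Fréchet derivative at the centre of a ball. -/
theorem norm_fderiv_le_div_of_forall_mem_ball (hR : 0 < R)
    (hd : DifferentiableOn ℂ f (ball c R)) (hC : ∀ z ∈ ball c R, ‖f z‖ ≤ C) :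
    ‖fderiv ℂ f c‖ ≤ C / R := by
  have hC0 : 0 ≤ C := (norm_nonneg _).trans (hC c (mem_ball_self hR))
  refine ContinuousLinearMap.opNorm_le_bound _ (by positivity) fun u => ?_
  rcases eq_or_ne u 0 with rfl | hu
  · simp
  have hu' : 0 < ‖u‖ := norm_pos_iff.2 hu
  have hmaps : MapsTo (fun ζ : ℂ => c + ζ • u) (ball 0 (R / ‖u‖)) (ball c R) := by
    intro ζ hζ
    simpa [norm_smul, lt_div_iff₀ hu'] using hζ
  have hline : HasDerivAt (fun ζ : ℂ => c + ζ • u) u 0 := by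
    simpa using ((hasDerivAt_id (0 : ℂ)).smul_const u).const_add c
  have hfc : HasFDerivAt f (fderiv ℂ f c) (c + (0 : ℂ) • u) := by
    simpa using (hd.differentiableAt (ball_mem_nhds c hR)).hasFDerivAt
  have hder := (hfc.comp_hasDerivAt (0 : ℂ) hline).deriv
  have := norm_deriv_le_div_of_forall_mem_ball (f := f ∘ fun ζ : ℂ => c + ζ • u) (C := C)
    (div_pos hR hu') (hd.comp (by fun_prop) hmaps) fun ζ hζ => hC _ (hmaps hζ)
  rw [hder] at this
  exact this.trans_eq (by field_simp)

theorem norm_sub_le_of_forall_mem_ball (hd : DifferentiableOn ℂ f (ball c R))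
    (hC : ∀ z ∈ ball c R, ‖f z‖ ≤ C) {r : ℝ} (hr : r < R) {x y : E}
    (hx : x ∈ closedBall c r) (hy : y ∈ closedBall c r) :
    ‖f x - f y‖ ≤ C / (R - r) * ‖x - y‖ := by
  have hsub : closedBall c r ⊆ ball c R := closedBall_subset_ball hr
  let : NormedSpace ℝ E := NormedSpace.restrictScalars ℝ ℂ E
  refine Convex.norm_image_sub_le_of_norm_fderiv_le (𝕜 := ℂ) (s := closedBall c r)
    (fun z hz => hd.differentiableAt (isOpen_ball.mem_nhds (hsub hz))) (fun z hz => ?_)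
    (convex_closedBall c r) hy hx
  have hz' : ball z (R - r) ⊆ ball c R := ball_subset_ball' (by
    have := mem_closedBall.1 hz
    linarith)
  exact norm_fderiv_le_div_of_forall_mem_ball (sub_pos.2 hr) (hd.mono hz')
    fun w hw => hC w (hz' hw)

/-- The derivative is continuous at `c`: Cauchy's estimate applies to `y ↦ f (y + (w - c)) - f y`,
which is small by the Lipschitz bound. Strictness is what the inverse function theorem needs. -/
theorem hasStrictFDerivAt_of_forall_mem_ball (hR : 0 < R)
    (hd : DifferentiableOn ℂ f (ball c R)) (hC : ∀ z ∈ ball c R, ‖f z‖ ≤ C) :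
    HasStrictFDerivAt f (fderiv ℂ f c) c := by
  have hdiff : ∀ z ∈ ball c R, DifferentiableAt ℂ f z := fun z hz =>
    hd.differentiableAt (isOpen_ball.mem_nhds hz)
  refine hasStrictFDerivAt_of_hasFDerivAt_of_continuousAt (f' := fderiv ℂ f)
    (Filter.eventually_of_mem (ball_mem_nhds c hR) fun z hz => (hdiff z hz).hasFDerivAt) ?_
  -- One `δ` for the point `y`, one for the shift, one as margin for the Lipschitz estimate.
  obtain ⟨δ, hδ, hδR⟩ : ∃ δ : ℝ, 0 < δ ∧ R = 3 * δ := ⟨R / 3, by positivity, by ring⟩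
  have hbound : ∀ w ∈ ball c δ, dist (fderiv ℂ f w) (fderiv ℂ f c) ≤ C / δ / δ * dist w c := by
    intro w hw
    have hw' : ‖w - c‖ < δ := by simpa [dist_eq_norm] using hw
    have hshift : MapsTo (fun y => y + (w - c)) (ball c δ) (closedBall c (2 * δ)) := by
      intro y hy
      have hy' : ‖y - c‖ < δ := by simpa [dist_eq_norm] using hy
      rw [mem_closedBall, dist_eq_norm, show y + (w - c) - c = (y - c) + (w - c) by abel]
      linarith [norm_add_le (y - c) (w - c)]
    have hsub : closedBall c (2 * δ) ⊆ ball c R := closedBall_subset_ball (by linarith)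
    have hsub' : ball c δ ⊆ closedBall c (2 * δ) :=
      ball_subset_closedBall.trans (closedBall_subset_closedBall (by linarith))
    have hshiftd : DifferentiableOn ℂ (fun y => f (y + (w - c))) (ball c δ) :=
      hd.comp (by fun_prop) fun y hy => hsub (hshift hy)
    have hk := norm_fderiv_le_div_of_forall_mem_ball (f := fun y => f (y + (w - c)) - f y)
      (C := C / δ * ‖w - c‖) hδ (hshiftd.sub (hd.mono (hsub'.trans hsub))) fun y hy => by
        have := norm_sub_le_of_forall_mem_ball hd hC (r := 2 * δ) (by linarith)
          (hshift hy) (hsub' hy)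
        rwa [add_sub_cancel_left, show R - 2 * δ = δ by linarith] at this
    rw [fderiv_fun_sub (hshiftd.differentiableAt (ball_mem_nhds c hδ))
      (hdiff c (mem_ball_self hR)), fderiv_comp_add_right, add_sub_cancel] at hk
    rw [dist_eq_norm, dist_eq_norm]
    exact hk.trans_eq (by ring)
  rw [ContinuousAt, tendsto_iff_dist_tendsto_zero]
  have hlim : Filter.Tendsto (fun w => C / δ / δ * dist w c) (nhds c) (nhds 0) := by
    have : Continuous fun w => C / δ / δ * dist w c := by fun_prop
    simpa using this.tendsto c
  exact squeeze_zero' (Filter.Eventually.of_forall fun _ => dist_nonneg)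
    (Filter.eventually_of_mem (ball_mem_nhds c hδ) hbound) hlim

end HolomorphicBounds

/-! ### Schwarz maps: numerical range, Euler polygons, quantitative Cartan theorem. -/

section SchwarzMaps

variable {X : Type*} [NormedAddCommGroup X] [NormedSpace ℂ X]

namespace IsSchwarzMap

variable {f : X → X}

theorem norm_lt_one (hf : IsSchwarzMap f) {z : X} (hz : z ∈ ball (0 : X) 1) : ‖f z‖ < 1 :=
  mem_ball_zero_iff.1 (hf.2.1 hz)

theorem norm_apply_le (hf : IsSchwarzMap f) {z : X} (hz : ‖z‖ < 1) : ‖f z‖ ≤ ‖z‖ :=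
  Complex.norm_le_norm_of_mapsTo_ball hf.1 (hf.2.1.mono_right ball_subset_closedBall) hf.2.2 hz

theorem norm_le_one_of_hasFDerivAt (hf : IsSchwarzMap f) {D : X →L[ℂ] X}
    (hD : HasFDerivAt f D 0) : ‖D‖ ≤ 1 := by
  have h := Complex.norm_fderiv_le_one_of_mapsTo_ball hf.1
    (by simpa [hf.2.2] using hf.2.1.mono_right ball_subset_closedBall) one_pos
  rwa [hD.fderiv] at h

theorem hasStrictFDerivAt (hf : IsSchwarzMap f) {z : X} (hz : z ∈ ball (0 : X) 1) :
    HasStrictFDerivAt f (fderiv ℂ f z) z := by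
  have hsub : ball z (1 - ‖z‖) ⊆ ball 0 1 := ball_subset_ball' (by simp)
  exact hasStrictFDerivAt_of_forall_mem_ball (C := 1) (by simpa using hz) (hf.1.mono hsub)
    fun w hw => (hf.norm_lt_one (hsub hw)).le

/-- Bound for the numerical range of `id - f` in terms of its linear part. -/
theorem norm_apply_sub_le (hf : IsSchwarzMap f) {D : X →L[ℂ] X} (hD : HasFDerivAt f D 0)
    {β R : ℝ} (hβ : 0 < β) (hDβ : ‖1 - D‖ ≤ β) (hR : R < 1) {z : X} (hz : ‖z‖ ≤ R)
    {l : X →L[ℂ] ℂ} (hl : ‖l‖ ≤ 1) (hlz : l z = ‖z‖) :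
    ‖l (z - f z)‖ ≤ 4 * β / (1 - R) := by
  have hR' : 0 < 1 - R := sub_pos.2 hR
  rcases eq_or_ne z 0 with rfl | hz0
  · simp only [hf.2.2, sub_self, map_zero, norm_zero]
    positivity
  have hzpos : 0 < ‖z‖ := norm_pos_iff.2 hz0
  have hle : ∀ x, ‖l x‖ ≤ ‖x‖ := fun x => by
    simpa using l.le_of_opNorm_le hl x
  set u : X := ((‖z‖ : ℂ)⁻¹) • z with hu
  have hun : ‖u‖ = 1 := by simp [hu, norm_smul, hzpos.ne']
  have hlu : l u = 1 := by simp [hu, hlz, hzpos.ne']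
  have hzu : ((‖z‖ : ℝ) : ℂ) • u = z := by simp [hu, smul_smul, hzpos.ne']
  have hmaps : MapsTo (fun ζ : ℂ => ζ • u) (ball 0 1) (ball 0 1) := by
    intro ζ hζ
    simpa [norm_smul, hun] using hζ
  set q : ℂ → ℂ := fun ζ => l (ζ • u - f (ζ • u)) with hq
  have hq0 : q 0 = 0 := by simp [hq, hf.2.2]
  have hqd : DifferentiableOn ℂ q (ball 0 1) := by
    have : DifferentiableOn ℂ (fun ζ : ℂ => f (ζ • u)) (ball 0 1) :=
      hf.1.comp (by fun_prop) hmaps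
    exact l.differentiable.comp_differentiableOn (DifferentiableOn.sub (by fun_prop) this)
  have hqder : HasDerivAt q (l ((1 - D) u)) 0 := by
    have hline : HasDerivAt (fun ζ : ℂ => ζ • u) u 0 := by
      simpa using (hasDerivAt_id (0 : ℂ)).smul_const u
    have hD' : HasFDerivAt f D ((0 : ℂ) • u) := by simpa using hD
    exact l.hasFDerivAt.comp_hasDerivAt (0 : ℂ) (hline.sub (hD'.comp_hasDerivAt (0 : ℂ) hline))
  set p : ℂ → ℂ := dslope q 0 with hp
  have hpd : DifferentiableOn ℂ p (ball 0 1) :=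
    (Complex.differentiableOn_dslope (ball_mem_nhds 0 one_pos)).2 hqd
  have hp0 : ‖p 0‖ ≤ β := by
    rw [hp, dslope_same, hqder.deriv]
    calc ‖l ((1 - D) u)‖ ≤ ‖(1 - D) u‖ := hle _
      _ ≤ β * ‖u‖ := (1 - D).le_of_opNorm_le hDβ u
      _ = β := by rw [hun, mul_one]
  have hpne : ∀ ζ : ℂ, ζ ≠ 0 → p ζ = q ζ / ζ := fun ζ hζ => by
    rw [hp, dslope_of_ne _ hζ, slope_def_field, hq0, sub_zero, sub_zero]
  -- Off the origin `Re p ≥ 0`, since the Schwarz lemma gives `‖l (f (ζ • u))‖ ≤ ‖ζ‖`. The level `β`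
  -- rather than `0` is the positive bound Borel–Carathéodory requires.
  have hmapsp : MapsTo (fun ζ => -p ζ) (ball 0 1) {w | w.re ≤ β} := by
    intro ζ hζ
    simp only [mem_ofPred_eq, Complex.neg_re]
    rcases eq_or_ne ζ 0 with rfl | hζ0
    · linarith [neg_le_abs (p 0).re, Complex.abs_re_le_norm (p 0)]
    · have hval : p ζ = 1 - l (f (ζ • u)) / ζ := by
        rw [hpne ζ hζ0, hq]
        simp only [map_sub, map_smul, hlu, smul_eq_mul, mul_one]
        field_simp
      have hn : ‖l (f (ζ • u)) / ζ‖ ≤ 1 := by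
        rw [norm_div, div_le_one (norm_pos_iff.2 hζ0)]
        refine (hle _).trans ((hf.norm_apply_le (mem_ball_zero_iff.1 (hmaps hζ))).trans_eq ?_)
        simp [norm_smul, hun]
      have hre := (Complex.re_le_norm (l (f (ζ • u)) / ζ)).trans hn
      rw [hval, Complex.sub_re, Complex.one_re]
      linarith
  have hzb : ((‖z‖ : ℝ) : ℂ) ∈ ball (0 : ℂ) 1 := by simpa using hz.trans_lt hR
  have hbc := Complex.borelCaratheodory hβ hpd.neg hmapsp one_pos hzb
  have hqz : l (z - f z) = ‖z‖ * p ‖z‖ := by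
    rw [hpne _ (by exact_mod_cast hzpos.ne'), hq]
    simp only [hzu]
    have : (‖z‖ : ℂ) ≠ 0 := by exact_mod_cast hzpos.ne'
    field_simp
  simp only [Pi.neg_apply, norm_neg, Complex.norm_real, norm_norm] at hbc
  rw [hqz, norm_mul, Complex.norm_real, norm_norm]
  have h1z : 0 < 1 - ‖z‖ := by linarith
  calc ‖z‖ * ‖p ‖z‖‖ ≤ 1 * ‖p ‖z‖‖ := by gcongr; linarith
    _ ≤ 2 * β * ‖z‖ / (1 - ‖z‖) + ‖p 0‖ * (1 + ‖z‖) / (1 - ‖z‖) := by rwa [one_mul]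
    _ ≤ 2 * β * 1 / (1 - ‖z‖) + β * (1 + 1) / (1 - ‖z‖) := by gcongr <;> linarith
    _ = 4 * β / (1 - ‖z‖) := by ring
    _ ≤ 4 * β / (1 - R) := by gcongr

end IsSchwarzMap

/-- The Euler polygon for the vector field `ζ • h` with unit time steps. -/
def eulerIterate (h : X → X) (z : X) : ℕ → ℂ → X
  | 0, _ => z
  | k + 1, ζ => eulerIterate h z k ζ + ζ • h (eulerIterate h z k ζ)

/-- One Euler step increases the norm by at most the numerical range bound, up to second order. -/
theorem norm_add_smul_le {h : X → X} {R K L C : ℝ} (hC0 : 0 ≤ C) (hL0 : 0 ≤ L)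
    (hC : ∀ w ∈ ball (0 : X) R, ‖h w‖ ≤ C)
    (hL : ∀ w ∈ ball (0 : X) R, ∀ w' ∈ ball (0 : X) R, ‖h w - h w'‖ ≤ L * ‖w - w'‖)
    (hnum : ∀ w ∈ ball (0 : X) R, ∀ l : X →L[ℂ] ℂ, ‖l‖ ≤ 1 → l w = ‖w‖ → ‖l (h w)‖ ≤ K)
    {δ : ℝ} {ζ : ℂ} (hζ : ‖ζ‖ ≤ δ) {w : X} (hw : ‖w‖ + δ * C < R) :
    ‖w + ζ • h w‖ ≤ ‖w‖ + (δ * K + δ ^ 2 * (L * C)) := by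
  have hδ : 0 ≤ δ := (norm_nonneg ζ).trans hζ
  have hwR : w ∈ ball (0 : X) R := by
    have : 0 ≤ δ * C := by positivity
    simpa using (by linarith : ‖w‖ < R)
  have hstep : ‖ζ • h w‖ ≤ δ * C := by
    rw [norm_smul]
    exact mul_le_mul hζ (hC w hwR) (norm_nonneg _) hδ
  set w' : X := w + ζ • h w with hw'
  have hwR' : w' ∈ ball (0 : X) R := by
    simpa using ((norm_add_le w (ζ • h w)).trans (by linarith)).trans_lt hw
  -- The functional is normed at the endpoint `w'`, so the numerical range bound applies to `h w'`;
  -- replacing `h w` by `h w'` costs the second-order Lipschitz term.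
  obtain ⟨l, hl, hlw⟩ := exists_dual_vector'' ℂ w'
  have hle : ∀ x, ‖l x‖ ≤ ‖x‖ := fun x => by simpa using l.le_of_opNorm_le hl x
  have hK : ‖l (h w')‖ ≤ K := hnum w' hwR' l hl (by simpa using hlw)
  have hdiff : ‖l (h w - h w')‖ ≤ L * (δ * C) := by
    refine (hle _).trans ((hL w hwR w' hwR').trans ?_)
    rw [hw', sub_add_cancel_left, norm_neg]
    gcongr
  have hsplit : l w' = l w + ζ * (l (h w') + l (h w - h w')) := by
    simp only [hw', map_add, map_smul, map_sub, smul_eq_mul]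
    ring
  calc ‖w'‖ = ‖l w'‖ := by rw [hlw]; simp
    _ ≤ ‖l w‖ + ‖ζ‖ * (‖l (h w')‖ + ‖l (h w - h w')‖) := by
      rw [hsplit]
      refine (norm_add_le _ _).trans ?_
      rw [norm_mul]
      gcongr
      exact norm_add_le _ _
    _ ≤ ‖w‖ + δ * (K + L * (δ * C)) := by
      gcongr
      exact hle w
    _ = _ := by ring

/-- A holomorphic vector field which is bounded and Lipschitz on a ball is bounded on smaller
balls in terms of the bound of its numerical range only. -/
theorem norm_le_of_numericalRange_le {h : X → X} {r R K L C : ℝ} (hrR : r < R)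
    (hK : 0 < K) (hC0 : 0 ≤ C) (hL0 : 0 ≤ L) (hd : DifferentiableOn ℂ h (ball 0 R))
    (hC : ∀ w ∈ ball (0 : X) R, ‖h w‖ ≤ C)
    (hL : ∀ w ∈ ball (0 : X) R, ∀ w' ∈ ball (0 : X) R, ‖h w - h w'‖ ≤ L * ‖w - w'‖)
    (hnum : ∀ w ∈ ball (0 : X) R, ∀ l : X →L[ℂ] ℂ, ‖l‖ ≤ 1 → l w = ‖w‖ → ‖l (h w)‖ ≤ K)
    {z : X} (hz : ‖z‖ ≤ r) : ‖h z‖ ≤ 2 * K * R / (R - r) := by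
  have hRr : 0 < R - r := sub_pos.2 hrR
  -- In time `ρ`, growth at rate `K` uses half of the gap `R - r`. For large `N`, the accumulated
  -- second-order error and the reserve `δ * C` for one step each take less than a quarter.
  set ρ : ℝ := (R - r) / (2 * K) with hρ
  have hρ0 : 0 < ρ := by positivity
  have hρK : ρ * K = (R - r) / 2 := by rw [hρ]; field_simp
  obtain ⟨N, hN⟩ := exists_nat_gt (max (4 * (ρ ^ 2 * (L * C)) / (R - r)) (4 * (ρ * C) / (R - r)))
  have hN0 : (0 : ℝ) < N :=
    lt_of_le_of_lt (le_max_of_le_right (by positivity)) hN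
  obtain ⟨δ, hδ⟩ : ∃ δ : ℝ, δ = ρ / N := ⟨_, rfl⟩
  have hδ0 : 0 < δ := by rw [hδ]; positivity
  have hNδ : N * δ = ρ := by rw [hδ]; field_simp
  have hN1 : ρ * δ * (L * C) < (R - r) / 4 := by
    have := (le_max_left _ _).trans_lt hN
    rw [div_lt_iff₀ hRr] at this
    rw [hδ, show ρ * (ρ / N) * (L * C) = ρ ^ 2 * (L * C) / N by ring, div_lt_iff₀ hN0]
    linarith
  have hN2 : δ * C < (R - r) / 4 := by
    have := (le_max_right _ _).trans_lt hN
    rw [div_lt_iff₀ hRr] at this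
    rw [hδ, show ρ / N * C = ρ * C / N by ring, div_lt_iff₀ hN0]
    linarith
  have hE : 0 ≤ δ * K + δ ^ 2 * (L * C) := by positivity
  have hbudget : ∀ k : ℕ, k ≤ N →
      r + k * (δ * K + δ ^ 2 * (L * C)) + δ * C < R := by
    intro k hk
    have hk' : (k : ℝ) * (δ * K + δ ^ 2 * (L * C)) ≤ N * (δ * K + δ ^ 2 * (L * C)) := by
      gcongr
    have : N * (δ * K + δ ^ 2 * (L * C)) = ρ * K + ρ * δ * (L * C) := by rw [← hNδ]; ring
    linarith
  have hnorm : ∀ k : ℕ, k ≤ N → ∀ ζ ∈ ball (0 : ℂ) δ,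
      ‖eulerIterate h z k ζ‖ ≤ r + k * (δ * K + δ ^ 2 * (L * C)) := by
    intro k
    induction k with
    | zero => intro _ ζ _; simpa [eulerIterate] using hz
    | succ k ih =>
      intro hk ζ hζ
      have hk' : k ≤ N := by omega
      have h1 := ih hk' ζ hζ
      have hζ' : ‖ζ‖ ≤ δ := (mem_ball_zero_iff.1 hζ).le
      have h2 := norm_add_smul_le hC0 hL0 hC hL hnum hζ' (w := eulerIterate h z k ζ)
        (by linarith [hbudget k hk'])
      rw [eulerIterate]
      push_cast
      linarith
  have hmem : ∀ k : ℕ, k ≤ N → MapsTo (eulerIterate h z k) (ball 0 δ) (ball 0 R) := by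
    intro k hk ζ hζ
    have h0 : 0 ≤ δ * C := by positivity
    simpa using (hnorm k hk ζ hζ).trans_lt (by linarith [hbudget k hk])
  have hdiff : ∀ k : ℕ, k ≤ N → DifferentiableOn ℂ (eulerIterate h z k) (ball 0 δ) := by
    intro k
    induction k with
    | zero => intro _; exact differentiableOn_const z
    | succ k ih =>
      intro hk
      have hk' : k ≤ N := by omega
      exact (ih hk').add (differentiableOn_id.smul (hd.comp (ih hk') (hmem k hk')))
  have hzero : ∀ k : ℕ, eulerIterate h z k 0 = z := by
    intro k
    induction k with
    | zero => rfl
    | succ k ih => simp [eulerIterate, ih]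
  have hder : ∀ k : ℕ, k ≤ N → HasDerivAt (eulerIterate h z k) ((k : ℂ) • h z) 0 := by
    intro k
    induction k with
    | zero => intro _; simpa [eulerIterate] using! hasDerivAt_const (0 : ℂ) z
    | succ k ih =>
      intro hk
      have hk' : k ≤ N := by omega
      have hcomp : DifferentiableAt ℂ (fun ζ => h (eulerIterate h z k ζ)) 0 :=
        (hd.comp (hdiff k hk') (hmem k hk')).differentiableAt (ball_mem_nhds 0 hδ0)
      have := (ih hk').add ((hasDerivAt_id (0 : ℂ)).smul hcomp.hasDerivAt)
      simp only [id, zero_smul, one_smul, zero_add, hzero] at this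
      rw [Nat.cast_succ, add_smul, one_smul]
      exact this
  -- The derivative in `ζ` at `0` is `N • h z`, and `N * δ = ρ`, so the auxiliary constants `C` and
  -- `L` drop out.
  have hcauchy := norm_deriv_le_div_of_forall_mem_ball hδ0 (hdiff N le_rfl)
    fun ζ hζ => (mem_ball_zero_iff.1 (hmem N le_rfl hζ)).le
  rw [(hder N le_rfl).deriv, norm_smul, Complex.norm_natCast, le_div_iff₀ hδ0] at hcauchy
  rw [le_div_iff₀ hRr]
  have h1 : ‖h z‖ * ρ ≤ R := by rw [← hNδ]; linarith
  calc ‖h z‖ * (R - r) = ‖h z‖ * ρ * (2 * K) := by rw [hρ]; field_simp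
    _ ≤ R * (2 * K) := by gcongr
    _ = 2 * K * R := by ring

/-- A quantitative form of Cartan's uniqueness theorem. -/
theorem IsSchwarzMap.norm_sub_apply_le {f : X → X} (hf : IsSchwarzMap f) {D : X →L[ℂ] X}
    (hD : HasFDerivAt f D 0) {r : ℝ} (hr : r < 1) {z : X} (hz : ‖z‖ ≤ r) :
    ‖z - f z‖ ≤ 32 / (1 - r) ^ 2 * ‖1 - D‖ := by
  have hr1 : 0 < 1 - r := sub_pos.2 hr
  have hr0 : 0 ≤ r := (norm_nonneg z).trans hz
  -- The strict inequality keeps `β` positive even when `D = 1`; the limit `β → ‖1 - D‖` is taken at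
  -- the end.
  have key : ∀ β : ℝ, ‖1 - D‖ < β → ‖z - f z‖ ≤ 32 / (1 - r) ^ 2 * β := by
    intro β hβ
    have hβ0 : 0 < β := (norm_nonneg _).trans_lt hβ
    set R : ℝ := (1 + r) / 2 with hRdef
    have hR1 : R < 1 := by rw [hRdef]; linarith
    have h1R : 1 - R = (1 - r) / 2 := by rw [hRdef]; ring
    have hRr : R - r = (1 - r) / 2 := by rw [hRdef]; ring
    have hsub : ball (0 : X) R ⊆ ball 0 1 := ball_subset_ball hR1.le
    have hd : DifferentiableOn ℂ (fun w => w - f w) (ball 0 1) := differentiableOn_id.sub hf.1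
    have hC : ∀ w ∈ ball (0 : X) 1, ‖w - f w‖ ≤ 2 := fun w hw => by
      linarith [norm_sub_le w (f w), mem_ball_zero_iff.1 hw, hf.norm_lt_one hw]
    have h := norm_le_of_numericalRange_le (h := fun w => w - f w) (r := r) (R := R)
      (K := 4 * β / (1 - R)) (L := 2 / (1 - R)) (C := 2) (by linarith)
      (div_pos (by positivity) (by linarith)) two_pos.le (div_pos two_pos (by linarith)).le
      (hd.mono hsub) (fun w hw => hC w (hsub hw))
      (fun w hw w' hw' => norm_sub_le_of_forall_mem_ball hd hC hR1
        (ball_subset_closedBall hw) (ball_subset_closedBall hw'))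
      (fun w hw l hl hlw => hf.norm_apply_sub_le hD hβ0 hβ.le hR1
        (mem_ball_zero_iff.1 hw).le hl hlw) hz
    refine h.trans ?_
    rw [h1R, hRr]
    calc 2 * (4 * β / ((1 - r) / 2)) * R / ((1 - r) / 2) = 32 / (1 - r) ^ 2 * β * R := by
          field_simp; ring
      _ ≤ 32 / (1 - r) ^ 2 * β * 1 := by gcongr
      _ = _ := mul_one _
  have hlim : Filter.Tendsto (fun β : ℝ => 32 / (1 - r) ^ 2 * β)
      (nhdsWithin ‖1 - D‖ (Ioi ‖1 - D‖)) (nhds (32 / (1 - r) ^ 2 * ‖1 - D‖)) :=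
    (tendsto_const_nhds.mul Filter.tendsto_id).mono_left nhdsWithin_le_nhds
  exact ge_of_tendsto hlim (Filter.eventually_of_mem self_mem_nhdsWithin key)

/-- By the inverse function theorem the map is open, and its global inverse is a local left inverse
near each point, hence differentiable at the image. -/
theorem IsBiholomorphicOn.of_injOn [CompleteSpace X] {Y : Type*} [NormedAddCommGroup Y]
    [NormedSpace ℂ Y] {f : X → Y} {Ω : Set X} (hΩ : IsOpen Ω) (hΩc : IsConnected Ω)
    (hinj : InjOn f Ω)
    (hf : ∀ z ∈ Ω, ∃ f' : X ≃L[ℂ] Y, HasStrictFDerivAt f (f' : X →L[ℂ] Y) z) :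
    IsBiholomorphicOn f Ω := by
  have hd : DifferentiableOn ℂ f Ω := fun z hz => by
    obtain ⟨f', hf'⟩ := hf z hz
    exact hf'.hasFDerivAt.differentiableAt.differentiableWithinAt
  refine ⟨hd, ?_, hΩc.image f hd.continuousOn, Function.invFunOn f Ω,
    hinj.leftInvOn_invFunOn, ?_⟩
  · rw [isOpen_iff_mem_nhds]
    rintro _ ⟨z, hz, rfl⟩
    obtain ⟨f', hf'⟩ := hf z hz
    rw [← hf'.map_nhds_eq_of_equiv]
    exact Filter.image_mem_map (hΩ.mem_nhds hz)
  · rintro _ ⟨z, hz, rfl⟩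
    obtain ⟨f', hf'⟩ := hf z hz
    exact (hf'.to_local_left_inverse (Filter.eventually_of_mem (hΩ.mem_nhds hz)
      hinj.leftInvOn_invFunOn)).hasFDerivAt.differentiableAt.differentiableWithinAt

end SchwarzMaps

/-! ### Estimates in time and invertibility of the derivatives. -/

namespace IsSchwarzSemigroupFamily

variable {X : Type*} [NormedAddCommGroup X] [NormedSpace ℂ X] {A : X →L[ℂ] X}
  {v : X → ℝ → ℝ → X}

theorem norm_exp_le_one (hv : IsSchwarzSemigroupFamily A v) {τ : ℝ} (hτ : 0 ≤ τ) :
    ‖NormedSpace.exp (-((τ : ℂ) • A))‖ ≤ 1 :=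
  (hv.schwarz 0 τ le_rfl hτ).norm_le_one_of_hasFDerivAt
    (by simpa using hv.deriv_zero 0 τ le_rfl hτ)

/-- Mean value inequality: contractivity of the exponential bounds its derivative by `‖A‖`, with no
factor growing in `τ`. -/
theorem norm_one_sub_exp_le [CompleteSpace X] (hv : IsSchwarzSemigroupFamily A v) {τ : ℝ}
    (hτ : 0 ≤ τ) : ‖1 - NormedSpace.exp (-((τ : ℂ) • A))‖ ≤ ‖A‖ * τ := by
  have hder : ∀ σ : ℝ, HasDerivAt (fun σ : ℝ => NormedSpace.exp (-((σ : ℂ) • A)))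
      (NormedSpace.exp (-((σ : ℂ) • A)) * -A) σ := fun σ => by
    simpa [Function.comp_def] using! (hasDerivAt_exp_smul_const (𝕂 := ℂ) (-A) (σ : ℂ)).scomp σ
      Complex.ofRealCLM.hasDerivAt
  have h := norm_image_sub_le_of_norm_deriv_le_segment' (C := ‖A‖)
    (fun σ (_ : σ ∈ Icc 0 τ) => (hder σ).hasDerivWithinAt) (fun σ hσ => by
      refine (norm_mul_le _ _).trans ?_
      rw [norm_neg]
      exact mul_le_of_le_one_left (norm_nonneg A) (hv.norm_exp_le_one hσ.1)) τ
    (right_mem_Icc.2 hτ)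
  rw [norm_sub_rev]
  simpa using h

theorem norm_sub_apply_le [CompleteSpace X] (hv : IsSchwarzSemigroupFamily A v) {s t r : ℝ}
    (hs : 0 ≤ s) (hst : s ≤ t) (hr : r < 1) {z : X} (hz : ‖z‖ ≤ r) :
    ‖z - v z s t‖ ≤ 32 / (1 - r) ^ 2 * ‖A‖ * (t - s) := by
  have hr1 : 0 < 1 - r := sub_pos.2 hr
  refine ((hv.schwarz s t hs hst).norm_sub_apply_le (hv.deriv_zero s t hs hst) hr hz).trans ?_
  rw [mul_assoc]
  gcongr
  exact hv.norm_one_sub_exp_le (sub_nonneg.2 hst)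

theorem apply_self [CompleteSpace X] (hv : IsSchwarzSemigroupFamily A v) {s : ℝ} (hs : 0 ≤ s)
    {z : X} (hz : z ∈ ball (0 : X) 1) : v z s s = z := by
  have h := hv.norm_sub_apply_le hs le_rfl (mem_ball_zero_iff.1 hz) le_rfl
  rw [sub_self, mul_zero, norm_le_zero_iff, sub_eq_zero] at h
  exact h.symm

/-- Cauchy's estimate for `id - v` makes the derivative closer than `1` to the identity. The step
`δ` is uniform in `s`, `t` and `z`, so that finitely many steps can be composed. -/
theorem exists_isUnit_fderiv_of_sub_le [CompleteSpace X] (hv : IsSchwarzSemigroupFamily A v)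
    {r : ℝ} (hr : r < 1) : ∃ δ > 0, ∀ s t : ℝ, 0 ≤ s → s ≤ t → t - s ≤ δ → ∀ z : X, ‖z‖ ≤ r →
      IsUnit (fderiv ℂ (fun z => v z s t) z) := by
  set R : ℝ := (1 + r) / 2 with hRdef
  have hRr : 0 < R - r := by rw [hRdef]; linarith
  have hR1 : R < 1 := by rw [hRdef]; linarith
  have h1R : 0 < 1 - R := sub_pos.2 hR1
  set B : ℝ := 32 / (1 - R) ^ 2 * ‖A‖ / (R - r) with hB
  have hB0 : 0 ≤ B := by positivity
  refine ⟨1 / (B + 1), by positivity, fun s t hs hst hδ z hz => ?_⟩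
  have hsub : ball z (R - r) ⊆ ball 0 R := ball_subset_ball' (by
    rw [dist_zero_right]; linarith)
  have hsub1 : ball (0 : X) R ⊆ ball 0 1 := ball_subset_ball hR1.le
  have hd := (hv.schwarz s t hs hst).1.mono (hsub.trans hsub1)
  have h := norm_fderiv_le_div_of_forall_mem_ball (f := fun w => w - v w s t) hRr
    (differentiableOn_id.sub hd)
    fun w hw => hv.norm_sub_apply_le hs hst hR1 (mem_ball_zero_iff.1 (hsub hw)).le
  rw [fderiv_fun_sub differentiableAt_fun_id (hd.differentiableAt (ball_mem_nhds z hRr)),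
    fderiv_fun_id] at h
  have hlt : ‖1 - fderiv ℂ (fun z => v z s t) z‖ < 1 := by
    refine h.trans_lt ?_
    calc 32 / (1 - R) ^ 2 * ‖A‖ * (t - s) / (R - r) = B * (t - s) := by rw [hB]; ring
      _ ≤ B * (1 / (B + 1)) := by gcongr
      _ < 1 := by rw [mul_one_div, div_lt_one (by positivity)]; linarith
  simpa using isUnit_one_sub_of_norm_lt_one hlt

theorem isUnit_fderiv [CompleteSpace X] (hv : IsSchwarzSemigroupFamily A v) {s t : ℝ}
    (hs : 0 ≤ s) (hst : s ≤ t) {z : X} (hz : z ∈ ball (0 : X) 1) :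
    IsUnit (fderiv ℂ (fun z => v z s t) z) := by
  obtain ⟨δ, hδ, hunit⟩ := hv.exists_isUnit_fderiv_of_sub_le (mem_ball_zero_iff.1 hz)
  have main : ∀ n : ℕ, ∀ t : ℝ, s ≤ t → t - s ≤ n * δ →
      IsUnit (fderiv ℂ (fun z => v z s t) z) := by
    intro n
    induction n with
    | zero =>
      intro t hst ht
      exact hunit s t hs hst (ht.trans (by simpa using hδ.le)) z le_rfl
    | succ n ih =>
      intro t hst ht
      -- The last step `[m, t]` has length at most `δ`. The same `δ` serves at `v z s m`, as Schwarz
      -- maps do not increase the norm.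
      set m : ℝ := max s (t - δ) with hm
      have hsm : s ≤ m := le_max_left _ _
      have hmt : m ≤ t := max_le hst (by linarith)
      have hm0 : 0 ≤ m := hs.trans hsm
      have hms : m - s ≤ n * δ := by
        push_cast at ht
        rw [hm, sub_le_iff_le_add]
        refine max_le ?_ (by linarith)
        have : 0 ≤ n * δ := by positivity
        linarith
      have hw := (hv.schwarz s m hs hsm).norm_apply_le (mem_ball_zero_iff.1 hz)
      have hw1 : v z s m ∈ ball (0 : X) 1 := (hv.schwarz s m hs hsm).2.1 hz
      have hchain : (fun z => v z s t) =ᶠ[nhds z] (fun w => v w m t) ∘ fun z => v z s m :=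
        Filter.eventually_of_mem (isOpen_ball.mem_nhds hz)
          fun y hy => (hv.semigroup s m t hs hsm hmt y hy).symm
      rw [hchain.fderiv_eq, fderiv_comp z
        ((hv.schwarz m t hm0 hmt).1.differentiableAt (isOpen_ball.mem_nhds hw1))
        ((hv.schwarz s m hs hsm).1.differentiableAt (isOpen_ball.mem_nhds hz))]
      exact (hunit m t hm0 hmt (by linarith [le_max_right s (t - δ)]) _ hw).mul (ih m hsm hms)
  obtain ⟨n, hn⟩ := exists_nat_ge ((t - s) / δ)
  exact main n t hst ((div_le_iff₀ hδ).1 hn)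

end IsSchwarzSemigroupFamily

/-! ### The main theorem. -/

theorem proposition3p1 :
    ∃ M M' : ℝ → ℝ,
      (∀ r ∈ Ioo (0 : ℝ) 1, 0 < M r ∧ 0 < M' r ∧ M' r = (1 + r) / (1 - r) * M r) ∧
      ∀ (X : Type*) [NormedAddCommGroup X] [NormedSpace ℂ X] [CompleteSpace X]
        (A : X →L[ℂ] X), 0 < lowerNumericalBound A →
        ∀ v : X → ℝ → ℝ → X, IsSchwarzSemigroupFamily A v →
          (∀ s : ℝ, 0 ≤ s → ∀ z ∈ ball (0 : X) 1, v z s s = z) ∧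
          (∀ r ∈ Ioo (0 : ℝ) 1, ∀ z : X, ‖z‖ ≤ r → ∀ s t₁ t₂ : ℝ, 0 ≤ s → s ≤ t₁ → t₁ < t₂ →
            ‖v z s t₁ - v z s t₂‖ ≤ M r * ‖A‖ * (t₂ - t₁)) ∧
          (∀ r ∈ Ioo (0 : ℝ) 1, ∀ z : X, ‖z‖ ≤ r → ∀ s₁ s₂ t : ℝ, 0 ≤ s₁ → s₁ < s₂ → s₂ ≤ t →
            ‖v z s₁ t - v z s₂ t‖ ≤ M' r * ‖A‖ * (s₂ - s₁)) ∧
          ((∀ s t : ℝ, 0 ≤ s → s ≤ t → IsUnivalentOn (fun z => v z s t) (ball 0 1)) →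
            ∀ s t : ℝ, 0 ≤ s → s ≤ t → IsBiholomorphicOn (fun z => v z s t) (ball 0 1)) := by
  have hpos : ∀ r ∈ Ioo (0 : ℝ) 1, 0 < 32 / (1 - r) ^ 2 ∧ 0 < (1 + r) / (1 - r) := by
    rintro r ⟨h0, h1⟩
    have := sub_pos.2 h1
    exact ⟨by positivity, by positivity⟩
  refine ⟨fun r => 32 / (1 - r) ^ 2, fun r => (1 + r) / (1 - r) * (32 / (1 - r) ^ 2),
    fun r hr => ⟨(hpos r hr).1, mul_pos (hpos r hr).2 (hpos r hr).1, rfl⟩, ?_⟩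
  intro X _ _ _ A _ v hv
  refine ⟨fun s hs z hz => hv.apply_self hs hz, ?_, ?_, ?_⟩
  · intro r hr z hz s t₁ t₂ hs hst ht
    have hz1 : ‖z‖ < 1 := hz.trans_lt hr.2
    rw [← hv.semigroup s t₁ t₂ hs hst ht.le z (mem_ball_zero_iff.2 hz1)]
    exact hv.norm_sub_apply_le (hs.trans hst) ht.le hr.2
      (((hv.schwarz s t₁ hs hst).norm_apply_le hz1).trans hz)
  · intro r hr z hz s₁ s₂ t hs hs₁₂ hst
    have hz1 : ‖z‖ < 1 := hz.trans_lt hr.2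
    have hr1 : 0 < 1 - r := sub_pos.2 hr.2
    have hs₂ : 0 ≤ s₂ := hs.trans hs₁₂.le
    have hg := hv.schwarz s₂ t hs₂ hst
    rw [← hv.semigroup s₁ s₂ t hs hs₁₂.le hst z (mem_ball_zero_iff.2 hz1), norm_sub_rev]
    -- The Lipschitz constant on `‖z‖ ≤ r` is `1 / (1 - r)`, which is then weakened to the
    -- prescribed `(1 + r) / (1 - r)`.
    have hlip := norm_sub_le_of_forall_mem_ball hg.1 (fun w hw => (hg.norm_lt_one hw).le) hr.2
      (mem_closedBall_zero_iff.2 hz) (mem_closedBall_zero_iff.2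
        (((hv.schwarz s₁ s₂ hs hs₁₂.le).norm_apply_le hz1).trans hz))
    refine hlip.trans ?_
    rw [mul_assoc ((1 + r) / (1 - r)), mul_assoc ((1 + r) / (1 - r))]
    refine mul_le_mul ?_ (hv.norm_sub_apply_le hs hs₁₂.le hr.2 hz) (norm_nonneg _)
      (hpos r hr).2.le
    gcongr
    linarith [hr.1]
  · intro huniv s t hs hst
    refine IsBiholomorphicOn.of_injOn isOpen_ball
      ⟨⟨0, mem_ball_self one_pos⟩, ?_⟩ (huniv s t hs hst).2 fun z hz => ?_
    · let : NormedSpace ℝ X := NormedSpace.restrictScalars ℝ ℂ X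
      exact (convex_ball (0 : X) 1).isPreconnected
    · obtain ⟨f', hf'⟩ := hv.isUnit_fderiv hs hst hz
      refine ⟨ContinuousLinearEquiv.ofUnit f', ?_⟩
      have h := (hv.schwarz s t hs hst).hasStrictFDerivAt hz
      rwa [← hf'] at h
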